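/- A group is cohopfian if each of its injective endomorphisms is surjective, and it has Property FA if each of its actions on a tree fixes a vertex or an edge (an edge being fixed as an unordered pair of vertices). Let $A$ and $B$ be cohopfian groups with Property FA, with a common cohopfian subgroup $C$ (that is, a cohopfian group $C$ with injective homomorphisms to $A$ and to $B$), and suppose that $C$ is equal to its normalizer in both $A$ and $B$. Then the amalgamated product $A *_C B$ is cohopfian. In particular, let $S_n$ be the symmetric group on $n$ elements, with $S_2\subset S_3$ the subgroup fixing the last element. The group $S_3 *_{S_2} S_3$ is cohopfian, finitely generated and not virtually cyclic, and it has a non-abelian free subgroup of index $6$, which is not cohopfian. Hence there is a cohopfian group among the non-elementary virtually free finitely generated groups, and being cohopfian does not pass to subgroups of finite index. -/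

import Mathlib

universe u

/-- A group is cohopfian if every injective endomorphism of it is surjective. -/
def IsCohopfian (G : Type*) [Group G] : Prop :=
  ∀ φ : G →* G, Function.Injective φ → Function.Surjective φ

/-- Property FA: every action on a tree (by graph automorphisms) fixes a vertex or an edge, where
fixing an edge means fixing it as an unordered pair of vertices. (Every action on a tree restricts
to an action on an invariant subtree spanned by one orbit, which has a copy in the universe of the
group, so it is enough to consider trees in that universe.) -/
def PropertyFA (G : Type u) [Group G] : Prop :=
  ∀ (V : Type u) (T : SimpleGraph V), T.IsTree → ∀ ρ : G →* (T ≃g T),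
    (∃ v : V, ∀ g : G, ρ g v = v) ∨ (∃ e ∈ T.edgeSet, ∀ g : G, Sym2.map (ρ g) e = e)

namespace Amalgam

/-- The two groups `A` and `B` as a family indexed by `Bool`. -/
def Factor (A B : Type u) : Bool → Type u
  | false => A
  | true => B

instance (A B : Type u) [Group A] [Group B] : ∀ i, Group (Factor A B i)
  | false => inferInstanceAs (Group A)
  | true => inferInstanceAs (Group B)

/-- The two maps `C → A` and `C → B` as a family indexed by `Bool`. -/
def factorMap {A B C : Type u} [Group A] [Group B] [Group C] (f : C →* A) (g : C →* B) :
    ∀ i, C →* Factor A B i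
  | false => f
  | true => g

end Amalgam

/-- The pushout of `f : C → A` and `g : C → B` in groups; for injective `f` and `g` this is the
amalgamated product `A *_C B`. -/
abbrev AmalgamatedProduct {A B C : Type u} [Group A] [Group B] [Group C]
    (f : C →* A) (g : C →* B) : Type u :=
  Monoid.PushoutI (Amalgam.factorMap f g)

/-- The standard inclusion of `S₂` in `S₃`, as the permutations fixing the last point. -/
noncomputable def symInclusion : Equiv.Perm (Fin 2) →* Equiv.Perm (Fin 3) :=
  Equiv.Perm.viaEmbeddingHom Fin.castSuccEmb

/-- The double `S₃ *_{S₂} S₃`. -/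
abbrev SymDouble : Type := AmalgamatedProduct symInclusion symInclusion

/-! Let an injective endomorphism `F` of the amalgam be given, and let both factors act through `F`
on the Bass–Serre tree. By Property FA, and since there are no inversions, the image of each factor
fixes a vertex, and `F(C)` fixes both vertices. As `C` is cohopfian and self-normalizing, two
distinct vertices fixed by a copy of `C` are adjacent (`exists_edge_of_fixed`). If the two vertices
agree, the whole image lies in a conjugate of one factor, and cohopficity of that factor forces the
amalgam to equal it. If they are adjacent, some conjugate `ψ` of `F` maps the factors into the
factors, possibly exchanging them; then `ψ ∘ ψ` maps each factor into itself, hence onto itself, and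
`ψ` is surjective (`isCohopfian_pushoutI`).

The graph is acyclic because its vertices map equivariantly to integral functions on the edges, for
an affine action under which the two ends of an edge differ by the indicator of that edge. Hence
every edge is a bridge.

For the example, finite groups are cohopfian and have Property FA, by taking centers of orbits. The
kernel of the folding map onto `S₃` is generated by the differences of the two copies of the
transpositions `(p 2)`; an action on a free group of rank three shows that these generate freely. A
free group of positive rank is not cohopfian, since squaring the generators is injective but not
surjective. -/

/-! ### The Bass–Serre tree of an amalgamated product of two groups -/

namespace Amalgam

open Monoid SimpleGraph

variable {G : Bool → Type u} {C : Type u} [∀ i, Group (G i)] [Group C] (φ : ∀ i, C →* G i)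

/-- The image of the `i`-th factor in the amalgamated product. -/
abbrev factor (i : Bool) : Subgroup (PushoutI φ) := (PushoutI.of (φ := φ) i).range

/-- The vertices of the Bass–Serre tree: the cosets of both factors. -/
abbrev Vertex : Type u := Σ i : Bool, PushoutI φ ⧸ factor φ i

variable {φ} in
/-- The coset of `g` of the factor `i`, as a vertex of the Bass–Serre tree. -/
abbrev vertex (i : Bool) (g : PushoutI φ) : Vertex φ := ⟨i, (g : PushoutI φ ⧸ factor φ i)⟩

/-- The Bass–Serre tree: the two cosets of any element are joined by an edge. -/
def bassSerre : SimpleGraph (Vertex φ) where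
  Adj v w := v.1 ≠ w.1 ∧ ∃ g, v = vertex v.1 g ∧ w = vertex w.1 g
  symm := ⟨fun _ _ ⟨h, g, hv, hw⟩ => ⟨h.symm, g, hw, hv⟩⟩
  loopless := ⟨fun _ h => h.1 rfl⟩

variable {φ}

theorem vertex_eq_iff {i : Bool} {g h : PushoutI φ} :
    vertex i g = vertex i h ↔ g⁻¹ * h ∈ factor φ i := by
  simp [vertex, QuotientGroup.eq]

theorem smul_vertex (i : Bool) (g h : PushoutI φ) : g • vertex i h = vertex i (g * h) := rfl

theorem exists_eq_vertex (v : Vertex φ) : ∃ g, v = vertex v.1 g := by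
  obtain ⟨i, x⟩ := v
  obtain ⟨g, rfl⟩ := QuotientGroup.mk_surjective x
  exact ⟨g, rfl⟩

theorem bassSerre_adj_vertex {i j : Bool} (h : i ≠ j) (g : PushoutI φ) :
    (bassSerre φ).Adj (vertex i g) (vertex j g) := ⟨h, g, rfl, rfl⟩

theorem base_mem_factor (i : Bool) (c : C) : PushoutI.base φ c ∈ factor φ i :=
  ⟨φ i c, PushoutI.of_apply_eq_base φ i c⟩

variable (φ) in
/-- The action on the Bass–Serre tree. -/
def bassSerreAction : PushoutI φ →* (bassSerre φ ≃g bassSerre φ) where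
  toFun g :=
    { MulAction.toPerm g with
      map_rel_iff' := by
        have key : ∀ (g : PushoutI φ) (v w : Vertex φ), (bassSerre φ).Adj v w →
            (bassSerre φ).Adj (g • v) (g • w) := by
          rintro g v w ⟨h, x, hv, hw⟩
          refine ⟨h, g * x, ?_, ?_⟩
          · rw [hv, smul_vertex]
          · rw [hw, smul_vertex]
        intro v w
        refine ⟨fun h => ?_, key g v w⟩
        simpa using key g⁻¹ _ _ h }
  map_one' := RelIso.ext fun v => one_smul (PushoutI φ) v
  map_mul' g h := RelIso.ext fun v => mul_smul g h v

/-! #### Acyclicity -/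

variable (φ) in
/-- The edges, as cosets of the amalgamated subgroup. -/
abbrev EdgeCoset : Type u := PushoutI φ ⧸ (PushoutI.base φ).range

variable (φ) in
/-- The permutation representation on integral functions on the edges. -/
def edgeRep : PushoutI φ →* Equiv.Perm (EdgeCoset φ → ℤ) :=
  letI := arrowAction (G := PushoutI φ) (A := EdgeCoset φ) (B := ℤ)
  MulAction.toPermHom (PushoutI φ) (EdgeCoset φ → ℤ)

theorem edgeRep_apply (g : PushoutI φ) (f : EdgeCoset φ → ℤ) (e : EdgeCoset φ) :
    edgeRep φ g f e = f (g⁻¹ • e) := rfl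

open Classical in
variable (φ) in
/-- The indicator function of the base edge. -/
noncomputable def edgeIndicator : EdgeCoset φ → ℤ :=
  fun e => if e = ((1 : PushoutI φ) : EdgeCoset φ) then 1 else 0

open Classical in
theorem edgeRep_edgeIndicator (g h : PushoutI φ) :
    edgeRep φ g (edgeIndicator φ) (h : EdgeCoset φ) =
      if (g : EdgeCoset φ) = h then 1 else 0 := by
  rw [edgeRep_apply, edgeIndicator]
  have : (g⁻¹ • (h : EdgeCoset φ) = ((1 : PushoutI φ) : EdgeCoset φ)) ↔
      (g : EdgeCoset φ) = h := by
    rw [inv_smul_eq_iff, eq_comm, MulAction.Quotient.smul_coe, smul_eq_mul, mul_one]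
  simp only [this]

theorem edgeRep_base_edgeIndicator (c : C) :
    edgeRep φ (PushoutI.base φ c) (edgeIndicator φ) = edgeIndicator φ := by
  classical
  funext e
  rw [edgeRep_apply, edgeIndicator, edgeIndicator]
  refine if_congr ?_ rfl rfl
  rw [inv_smul_eq_iff, MulAction.Quotient.smul_coe, smul_eq_mul, mul_one,
    show ((PushoutI.base φ c : PushoutI φ) : EdgeCoset φ) = ((1 : PushoutI φ) : EdgeCoset φ) from
      QuotientGroup.eq.2 (by simp [← map_inv])]

variable (φ) in
/-- The affine action for which the coordinate of an edge separates the endpoints of this edge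
only: the first factor acts linearly, the second one fixes the indicator of the base edge. -/
noncomputable def edgeAffine : PushoutI φ →* Equiv.Perm (EdgeCoset φ → ℤ) :=
  PushoutI.lift
    (fun
      | false => (edgeRep φ).comp (PushoutI.of false)
      | true => (MulAut.conj (Equiv.addRight (edgeIndicator φ))).toMonoidHom.comp
          ((edgeRep φ).comp (PushoutI.of true)))
    ((edgeRep φ).comp (PushoutI.base φ)) <| by
    rintro (_ | _)
    · ext c : 1
      simp [PushoutI.of_apply_eq_base]
    -- The subgroup `C` fixes the indicator of the base edge, so conjugating by the translation
    -- changes nothing on `C`.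
    · ext c f e
      have h := congrFun (edgeRep_base_edgeIndicator (φ := φ) c) e
      simp only [edgeRep_apply] at h
      simp [PushoutI.of_apply_eq_base, edgeRep_apply, h, Equiv.addRight]

theorem edgeAffine_of_false (a : G false) :
    edgeAffine φ (PushoutI.of false a) = edgeRep φ (PushoutI.of false a) :=
  PushoutI.lift_of ..

theorem edgeAffine_of_true (b : G true) (f : EdgeCoset φ → ℤ) :
    edgeAffine φ (PushoutI.of true b) f =
      edgeRep φ (PushoutI.of true b) (f - edgeIndicator φ) + edgeIndicator φ := by
  rw [edgeAffine, PushoutI.lift_of]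
  rfl

theorem edgeRep_sub (g : PushoutI φ) (f f' : EdgeCoset φ → ℤ) :
    edgeRep φ g (f - f') = edgeRep φ g f - edgeRep φ g f' := rfl

/-- Both factors act by affine maps with linear part `edgeRep`, and linear parts multiply. -/
theorem edgeAffine_sub (g : PushoutI φ) : ∀ f f' : EdgeCoset φ → ℤ,
    edgeAffine φ g f - edgeAffine φ g f' = edgeRep φ g (f - f') := by
  have hof : ∀ i (x : G i) (f f' : EdgeCoset φ → ℤ),
      edgeAffine φ (PushoutI.of i x) f - edgeAffine φ (PushoutI.of i x) f' =
        edgeRep φ (PushoutI.of i x) (f - f') := by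
    rintro (_ | _) x f f'
    · rw [edgeAffine_of_false, edgeRep_sub]
    · simp only [edgeAffine_of_true, edgeRep_sub]
      abel
  induction g using PushoutI.induction_on with
  | of i x => exact hof i x
  | base c => rw [← PushoutI.of_apply_eq_base φ false]; exact hof false _
  | mul x y hx hy =>
    intro f f'
    simp only [map_mul, Equiv.Perm.mul_apply, hx, hy]

variable (φ) in
/-- The fixed points of the two factors under the affine action. -/
noncomputable def basePoint : Bool → (EdgeCoset φ → ℤ)
  | false => 0
  | true => edgeIndicator φ

theorem edgeAffine_basePoint {i : Bool} {g : PushoutI φ} (hg : g ∈ factor φ i) :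
    edgeAffine φ g (basePoint φ i) = basePoint φ i := by
  obtain ⟨x, rfl⟩ := hg
  cases i
  · rw [edgeAffine_of_false]; rfl
  · rw [edgeAffine_of_true, basePoint, sub_self]
    funext e
    simp [edgeRep_apply]

/-- The equivariant map from the vertices to the affine space of functions on edges. -/
noncomputable def vertexPoint (v : Vertex φ) : EdgeCoset φ → ℤ :=
  Quotient.liftOn' v.2 (fun g => edgeAffine φ g (basePoint φ v.1)) fun g h hgh => by
    rw [QuotientGroup.leftRel_apply] at hgh
    have := edgeAffine_basePoint hgh
    rw [map_mul, Equiv.Perm.mul_apply, map_inv, Equiv.Perm.inv_eq_iff_eq] at this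
    exact this.symm

theorem vertexPoint_vertex (i : Bool) (g : PushoutI φ) :
    vertexPoint (vertex i g) = edgeAffine φ g (basePoint φ i) := rfl

theorem vertexPoint_sub (g : PushoutI φ) :
    vertexPoint (vertex true g) - vertexPoint (vertex false g) =
      edgeRep φ g (edgeIndicator φ) := by
  rw [vertexPoint_vertex, vertexPoint_vertex, edgeAffine_sub, basePoint, basePoint, sub_zero]

theorem vertex_eq_of_edgeCoset_eq {g h : PushoutI φ} (e : (g : EdgeCoset φ) = h) (i : Bool) :
    vertex i g = vertex i h := by
  rw [QuotientGroup.eq] at e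
  obtain ⟨c, hc⟩ := e
  rw [vertex_eq_iff, ← hc]
  exact base_mem_factor i c

/-- If a function on the vertices separates the endpoints of only one edge, then that edge is a
bridge. -/
theorem _root_.SimpleGraph.isBridge_of_separates {V α : Type*} {T : SimpleGraph V} {u w : V}
    (χ : V → α) (hne : χ u ≠ χ w)
    (h : ∀ x y, T.Adj x y → s(x, y) ≠ s(u, w) → χ x = χ y) : T.IsBridge s(u, w) := by
  rw [isBridge_iff]
  rintro ⟨p⟩
  apply hne
  clear hne
  have : ∀ {a b : V}, (T.deleteEdges {s(u, w)}).Walk a b → χ a = χ b := by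
    intro a b p
    induction p with
    | nil => rfl
    | cons hadj _ ih =>
      rw [deleteEdges_adj] at hadj
      exact (h _ _ hadj.1 hadj.2).trans ih
  exact this p

/-- By `vertexPoint_sub`, the coordinate of `vertexPoint` at the edge of `g` jumps across this edge
and is constant across every other edge. -/
theorem isBridge_vertex (g : PushoutI φ) :
    (bassSerre φ).IsBridge s(vertex false g, vertex true g) := by
  classical
  have key : ∀ h : PushoutI φ, vertexPoint (vertex true h) (g : EdgeCoset φ) -
      vertexPoint (vertex false h) (g : EdgeCoset φ) =
        if (h : EdgeCoset φ) = g then 1 else 0 := fun h => by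
    rw [← edgeRep_edgeIndicator, ← vertexPoint_sub, Pi.sub_apply]
  refine isBridge_of_separates (fun v => vertexPoint v (g : EdgeCoset φ)) ?_ ?_
  · have := key g
    rw [if_pos rfl] at this
    intro h
    omega
  · have aux : ∀ h : PushoutI φ, s(vertex false h, vertex true h) ≠
        s(vertex false g, vertex true g) →
        vertexPoint (vertex true h) (g : EdgeCoset φ) =
          vertexPoint (vertex false h) (g : EdgeCoset φ) := fun h hne => by
      have := key h
      rw [if_neg fun e => hne (by
        rw [vertex_eq_of_edgeCoset_eq e false, vertex_eq_of_edgeCoset_eq e true])] at this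
      omega
    rintro ⟨i, x⟩ ⟨j, y⟩ ⟨hij, h, hx, hy⟩ hne
    simp only at hij hx hy
    rw [hx, hy] at hne ⊢
    cases i <;> cases j
    · exact absurd rfl hij
    · exact (aux h hne).symm
    · exact aux h (by rwa [Sym2.eq_swap])
    · exact absurd rfl hij

variable (φ) in
theorem bassSerre_isAcyclic : (bassSerre φ).IsAcyclic := by
  rw [isAcyclic_iff_forall_adj_isBridge]
  rintro ⟨i, x⟩ ⟨j, y⟩ ⟨hij, h, hx, hy⟩
  simp only at hij hx hy
  rw [hx, hy]
  cases i <;> cases j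
  · exact absurd rfl hij
  · exact isBridge_vertex h
  · rw [Sym2.eq_swap]; exact isBridge_vertex h
  · exact absurd rfl hij

-- Right multiplication by an element of a factor keeps the coset of that factor, so it moves a
-- vertex within its component; the factors generate the group.
variable (φ) in
theorem bassSerre_connected : (bassSerre φ).Connected := by
  have hadj : ∀ (g : PushoutI φ) (i j : Bool),
      (bassSerre φ).Reachable (vertex i g) (vertex j g) := by
    intro g i j
    by_cases h : i = j
    · rw [h]
    · exact (bassSerre_adj_vertex h g).reachable
  have hof : ∀ (i : Bool) (x : G i) (h : PushoutI φ), (bassSerre φ).Reachable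
      (vertex false h) (vertex false (h * PushoutI.of i x)) := by
    intro i x h
    refine (hadj h false i).trans (Reachable.trans ?_ (hadj _ i false))
    rw [show vertex i h = vertex i (h * PushoutI.of i x) from vertex_eq_iff.2 (by simp)]
  have hstep : ∀ g h : PushoutI φ, (bassSerre φ).Reachable
      (vertex false h) (vertex false (h * g)) := by
    intro g
    induction g using PushoutI.induction_on with
    | of i x => exact hof i x
    | base c => rw [← PushoutI.of_apply_eq_base φ false]; exact hof false _
    | mul x y hx hy =>
      intro h
      rw [← mul_assoc]
      exact (hx h).trans (hy _)
  have h1 : ∀ v : Vertex φ, (bassSerre φ).Reachable (vertex false 1) v := by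
    intro v
    obtain ⟨g, hg⟩ := exists_eq_vertex v
    rw [hg]
    have := hstep g 1
    rw [one_mul] at this
    exact this.trans (hadj g _ _)
  exact { preconnected := fun v w => (h1 v).symm.trans (h1 w), nonempty := ⟨vertex false 1⟩ }

variable (φ) in
theorem bassSerre_isTree : (bassSerre φ).IsTree :=
  { connected := bassSerre_connected φ
    isAcyclic := bassSerre_isAcyclic φ }

end Amalgam

/-! ### Fixed points in trees -/

/-- An automorphism of an acyclic graph that fixes the ends of a path fixes the path. -/
theorem SimpleGraph.IsAcyclic.map_getVert_eq {V : Type*} {T : SimpleGraph V} (hT : T.IsAcyclic)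
    (σ : T ≃g T) {u w : V} (hu : σ u = u) (hw : σ w = w) {p : T.Walk u w} (hp : p.IsPath)
    (n : ℕ) : σ (p.getVert n) = p.getVert n := by
  have hmap : (p.map σ.toHom).IsPath := hp.map σ.injective
  have h := congrArg Subtype.val ((hT.subsingleton_path u w).elim
    ⟨(p.map σ.toHom).copy hu hw, by simpa using hmap⟩ ⟨p, hp⟩)
  have h' := congrArg (fun q : T.Walk u w => q.getVert n) h
  simpa using h'

/-- An embedding of a cohopfian group into the image of another embedding is onto that image. -/
theorem IsCohopfian.range_eq {K G : Type*} [Group K] [Group G] (hK : IsCohopfian K)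
    {j θ : K →* G} (hj : Function.Injective j) (hθ : Function.Injective θ)
    (h : θ.range ≤ j.range) : θ.range = j.range := by
  refine le_antisymm h ?_
  have hmem : ∀ k, θ k ∈ j.range := fun k => h ⟨k, rfl⟩
  let e := MonoidHom.ofInjective hj
  -- Cohopficity is applied to the injective endomorphism `j⁻¹ ∘ θ` of `K`.
  have hsurj := hK (e.symm.toMonoidHom.comp (θ.codRestrict _ hmem)) fun x y hxy => by
    have := e.symm.injective hxy
    exact hθ (congrArg Subtype.val this)
  rintro _ ⟨k, rfl⟩
  obtain ⟨l, hl⟩ := hsurj k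
  refine ⟨l, ?_⟩
  have : θ.codRestrict _ hmem l = e k := e.symm_apply_eq.1 hl
  exact congrArg Subtype.val this

/-! ### The criterion for amalgamated products -/

namespace Amalgam

open Monoid SimpleGraph

variable {G : Bool → Type u} {C : Type u} [∀ i, Group (G i)] [Group C] {φ : ∀ i, C →* G i}

theorem eq_top_of_factor_le {K : Subgroup (PushoutI φ)} (h : ∀ i, factor φ i ≤ K) : K = ⊤ := by
  refine eq_top_iff.2 fun g _ => ?_
  induction g using PushoutI.induction_on with
  | of i x => exact h i ⟨x, rfl⟩
  | base c => exact h false (base_mem_factor false c)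
  | mul x y hx hy => exact K.mul_mem (hx trivial) (hy trivial)

theorem smul_vertex_eq_iff {i : Bool} {c g : PushoutI φ} :
    c • vertex i g = vertex i g ↔ g⁻¹ * c * g ∈ factor φ i := by
  rw [smul_vertex, eq_comm, vertex_eq_iff, mul_assoc]

/-- A group with Property FA has a fixed vertex in the Bass–Serre tree, as there are no
inversions. -/
theorem exists_fixed_vertex {A : Type u} [Group A] (hA : PropertyFA A) (θ : A →* PushoutI φ) :
    ∃ v : Vertex φ, ∀ a, θ a • v = v := by
  obtain h | ⟨e, he, h⟩ :=
    hA (Vertex φ) (bassSerre φ) (bassSerre_isTree φ) ((bassSerreAction φ).comp θ)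
  · exact h
  · induction e with
    | _ v w =>
    refine ⟨v, fun a => ?_⟩
    have ha := h a
    rw [Sym2.map_mk, Sym2.eq_iff] at ha
    obtain ha | ha := ha
    · exact ha.1
    -- The action preserves the type of a coset, while adjacent vertices have different types.
    · exact absurd (congrArg Sigma.fst ha.1) (mem_edgeSet _ |>.1 he).1

/-- If `C` is cohopfian and self-normalizing in both factors, then it fixes no edge but its own. -/
theorem eq_vertex_of_adj_of_fixed (hφ : ∀ i, Function.Injective (φ i)) (hC : IsCohopfian C)
    (hN : ∀ i, Subgroup.normalizer ((φ i).range : Set (G i)) = (φ i).range)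
    {i j : Bool} (hij : i ≠ j) {y : Vertex φ} (hadj : (bassSerre φ).Adj (vertex i 1) y)
    (hfix : ∀ c, PushoutI.base φ c • y = y) : y = vertex j 1 := by
  obtain ⟨hne, h, h1, hy⟩ := hadj
  obtain ⟨k, y⟩ := y
  obtain rfl : k = j := by revert hij hne; simp only; cases i <;> cases j <;> cases k <;> simp
  simp only at hy h1
  rw [hy] at hfix ⊢
  rw [vertex_eq_iff, inv_one, one_mul] at h1
  obtain ⟨x, rfl⟩ := h1
  -- The neighbour is the translate by `x` of the other base vertex. Since `C` fixes it and lies in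
  -- the factor of `x`, `x⁻¹Cx` lies in both factors, whose intersection is `C`. Cohopficity turns
  -- this inclusion into an equality, so `x` normalizes `C` and hence lies in `C`.
  have hsub : ∀ c, (PushoutI.of (φ := φ) i x)⁻¹ * PushoutI.base φ c * PushoutI.of i x ∈
      (PushoutI.base φ).range := by
    intro c
    rw [← PushoutI.inf_of_range_eq_base_range hφ hij]
    refine ⟨?_, smul_vertex_eq_iff.1 (hfix c)⟩
    have hx : PushoutI.of (φ := φ) i x ∈ factor φ i := ⟨x, rfl⟩
    exact (factor φ i).mul_mem ((factor φ i).mul_mem ((factor φ i).inv_mem hx) (base_mem_factor i c)) hx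
  have heq := hC.range_eq (j := φ i) (θ := (MulAut.conj x⁻¹).toMonoidHom.comp (φ i)) (hφ i)
    ((MulAut.conj x⁻¹).injective.comp (hφ i)) <| by
      rintro _ ⟨c, rfl⟩
      obtain ⟨d, hd⟩ := hsub c
      refine ⟨d, PushoutI.of_injective hφ i ?_⟩
      rw [PushoutI.of_apply_eq_base, hd]
      simp [PushoutI.of_apply_eq_base]
  have hx : x⁻¹ ∈ Subgroup.normalizer ((φ i).range : Set (G i)) := by
    rw [Subgroup.mem_normalizer_iff]
    intro z
    refine ⟨?_, ?_⟩
    · rintro ⟨c, rfl⟩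
      rw [← heq]
      exact ⟨c, by simp⟩
    · intro hz
      rw [← heq] at hz
      obtain ⟨c, hc⟩ := hz
      exact ⟨c, by simpa using hc⟩
  rw [hN] at hx
  obtain ⟨c, hc⟩ := hx
  rw [vertex_eq_iff, mul_one, ← map_inv, ← hc, PushoutI.of_apply_eq_base]
  exact base_mem_factor k c

/-- A copy of `C` that fixes two distinct vertices fixes an edge between them. -/
theorem exists_edge_of_fixed (hφ : ∀ i, Function.Injective (φ i)) (hC : IsCohopfian C)
    (hN : ∀ i, Subgroup.normalizer ((φ i).range : Set (G i)) = (φ i).range)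
    {θ : C →* PushoutI φ} (hθ : Function.Injective θ) {v w : Vertex φ} (hvw : v ≠ w)
    (hv : ∀ c, θ c • v = v) (hw : ∀ c, θ c • w = w) :
    ∃ (i j : Bool) (h : PushoutI φ), i ≠ j ∧ v = vertex i h ∧ w = vertex j h := by
  obtain ⟨p, hp, -⟩ := (bassSerre_isTree φ).existsUnique_path v w
  have hfix : ∀ n c, θ c • p.getVert n = p.getVert n := fun n c =>
    (bassSerre_isAcyclic φ).map_getVert_eq (bassSerreAction φ (θ c)) (hv c) (hw c) hp n
  cases p with
  | nil => exact absurd rfl hvw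
  | @cons _ x _ hadj q =>
    have hx : ∀ c, θ c • x = x := fun c => by simpa using hfix 1 c
    obtain ⟨hij, h, hvh, hxh⟩ := hadj
    cases q with
    | nil => exact ⟨_, _, h, hij, hvh, hxh⟩
    | @cons _ y _ hadj' q =>
      -- Let the path continue from `v` through `x` to `y`. Translating by `h⁻¹` moves the first
      -- edge to the base edge, whose stabilizer `C` then equals the conjugated copy of `C`, by
      -- cohopficity. So `C` fixes `h⁻¹ • y`, which must be the other end of the base edge, and `y =
      -- v`.
      exfalso
      have hy : ∀ c, θ c • y = y := fun c => by
        simpa [Walk.getVert] using hfix 2 c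
      have hvy : v ≠ y := by
        rintro rfl
        refine ((Walk.cons_isPath_iff _ _).1 hp).2 ?_
        rw [Walk.support_cons]
        exact List.mem_cons_of_mem _ q.start_mem_support
      obtain ⟨i, v⟩ := v
      obtain ⟨j, x⟩ := x
      simp only at hij hvh hxh
      have heq := hC.range_eq (j := PushoutI.base φ)
        (θ := (MulAut.conj h⁻¹).toMonoidHom.comp θ) (PushoutI.base_injective hφ)
        ((MulAut.conj h⁻¹).injective.comp hθ) <| by
          rintro _ ⟨c, rfl⟩
          rw [← PushoutI.inf_of_range_eq_base_range hφ hij]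
          rw [hvh] at hv
          rw [hxh] at hx
          have h1 := smul_vertex_eq_iff.1 (hv c)
          have h2 := smul_vertex_eq_iff.1 (hx c)
          exact ⟨by simpa using h1, by simpa using h2⟩
      have := eq_vertex_of_adj_of_fixed hφ hC hN hij.symm (y := h⁻¹ • y) ?_ ?_
      · rw [inv_smul_eq_iff, smul_vertex, mul_one, ← hvh] at this
        exact hvy this.symm
      · rw [hxh] at hadj'
        have : (bassSerre φ).Adj (h⁻¹ • vertex j h) (h⁻¹ • y) :=
          (bassSerreAction φ h⁻¹).map_adj_iff.2 hadj'
        rwa [smul_vertex, inv_mul_cancel] at this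
      · intro c
        have hc : PushoutI.base φ c ∈ ((MulAut.conj h⁻¹).toMonoidHom.comp θ).range :=
          heq ▸ ⟨c, rfl⟩
        obtain ⟨d, hd⟩ := hc
        rw [← hd]
        have : ((MulAut.conj h⁻¹).toMonoidHom.comp θ) d = h⁻¹ * θ d * h := by simp
        rw [this, ← mul_smul, mul_assoc, mul_assoc, mul_inv_cancel, mul_one, mul_smul, hy]

theorem isCohopfian_pushoutI (hφ : ∀ i, Function.Injective (φ i)) (hG : ∀ i, IsCohopfian (G i))
    (hC : IsCohopfian C) (hFA : ∀ i, PropertyFA (G i))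
    (hN : ∀ i, Subgroup.normalizer ((φ i).range : Set (G i)) = (φ i).range) :
    IsCohopfian (PushoutI φ) := by
  intro F hF
  choose v hv using fun i => exists_fixed_vertex (hFA i) (F.comp (PushoutI.of (φ := φ) i))
  have hof : ∀ i, Function.Injective (PushoutI.of (φ := φ) i) := PushoutI.of_injective hφ
  have hconj : ∀ h : PushoutI φ, Function.Injective ((MulAut.conj h⁻¹).toMonoidHom.comp F) :=
    fun h => (MulAut.conj h⁻¹).injective.comp hF
  have hsurj : ∀ h : PushoutI φ,
      Function.Surjective ((MulAut.conj h⁻¹).toMonoidHom.comp F) → Function.Surjective F := by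
    intro h hs x
    obtain ⟨y, hy⟩ := hs (MulAut.conj h⁻¹ x)
    exact ⟨y, (MulAut.conj h⁻¹).injective hy⟩
  have hmem : ∀ {k i : Bool} {h : PushoutI φ}, v k = vertex i h → ∀ x,
      (MulAut.conj h⁻¹).toMonoidHom.comp F (PushoutI.of k x) ∈ factor φ i := by
    intro k i h hk x
    have h1 := hv k x
    rw [hk] at h1
    simpa using smul_vertex_eq_iff.1 h1
  by_cases hvv : v false = v true
  · obtain ⟨h, hh⟩ := exists_eq_vertex (v false)
    set i := (v false).1
    apply hsurj h
    set ψ := (MulAut.conj h⁻¹).toMonoidHom.comp F with hψ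
    have hall : ∀ g, ψ g ∈ factor φ i := by
      have : (factor φ i).comap ψ = ⊤ := by
        refine eq_top_of_factor_le fun k => ?_
        rintro _ ⟨x, rfl⟩
        cases k
        · exact hmem hh x
        · exact hmem (hvv ▸ hh) x
      intro g
      have hg : g ∈ (factor φ i).comap ψ := this ▸ trivial
      exact hg
    have heq := (hG i).range_eq (hof i) (θ := ψ.comp (PushoutI.of i))
      ((hconj h).comp (hof i)) (by rintro _ ⟨x, rfl⟩; exact hall _)
    -- The factor `i` alone already attains every value of `ψ`, so by injectivity it is the whole
    -- group.
    have htop : ∀ g, g ∈ factor φ i := by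
      intro g
      have hg : ψ g ∈ (ψ.comp (PushoutI.of i)).range := heq ▸ hall g
      obtain ⟨x, hx⟩ := hg
      exact ⟨x, hconj h hx⟩
    intro g
    have hg : g ∈ (ψ.comp (PushoutI.of i)).range := heq ▸ htop g
    obtain ⟨x, hx⟩ := hg
    exact ⟨_, hx⟩
  · have hvC : ∀ k c, F.comp (PushoutI.base φ) c • v k = v k := by
      intro k c
      have := hv k (φ k c)
      rwa [MonoidHom.comp_apply, PushoutI.of_apply_eq_base] at this
    obtain ⟨i, j, h, hij, hi, hj⟩ := exists_edge_of_fixed hφ hC hN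
      (θ := F.comp (PushoutI.base φ)) (hF.comp (PushoutI.base_injective hφ)) hvv
      (hvC false) (hvC true)
    apply hsurj h
    have hfalse := hmem hi
    have htrue := hmem hj
    set ψ := (MulAut.conj h⁻¹).toMonoidHom.comp F with hψ
    -- The map `ψ` either preserves both factors or exchanges them; its square preserves them in
    -- both cases.
    have hψψ : ∀ k x, ψ (ψ (PushoutI.of k x)) ∈ factor φ k := by
      intro k x
      cases i <;> cases j
      · exact absurd rfl hij
      · cases k
        · obtain ⟨y, hy⟩ := hfalse x
          rw [← hy]; exact hfalse y
        · obtain ⟨y, hy⟩ := htrue x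
          rw [← hy]; exact htrue y
      · cases k
        · obtain ⟨y, hy⟩ := hfalse x
          rw [← hy]; exact htrue y
        · obtain ⟨y, hy⟩ := htrue x
          rw [← hy]; exact hfalse y
      · exact absurd rfl hij
    have htop : ψ.range = ⊤ := by
      refine eq_top_of_factor_le fun k => ?_
      rw [factor, ← (hG k).range_eq (hof k) (θ := (ψ.comp ψ).comp (PushoutI.of k))
        (((hconj h).comp (hconj h)).comp (hof k)) (by rintro _ ⟨x, rfl⟩; exact hψψ k x)]
      rintro _ ⟨x, rfl⟩
      exact ⟨_, rfl⟩
    exact MonoidHom.range_eq_top.1 htop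

theorem isCohopfian_amalgamatedProduct {A B C : Type u} [Group A] [Group B] [Group C]
    (f : C →* A) (g : C →* B) (hf : Function.Injective f) (hg : Function.Injective g)
    (hA : IsCohopfian A) (hB : IsCohopfian B) (hC : IsCohopfian C)
    (hA' : PropertyFA A) (hB' : PropertyFA B)
    (hNf : Subgroup.normalizer (f.range : Set A) = f.range)
    (hNg : Subgroup.normalizer (g.range : Set B) = g.range) :
    IsCohopfian (AmalgamatedProduct f g) :=
  isCohopfian_pushoutI (fun | false => hf | true => hg) (fun | false => hA | true => hB) hC
    (fun | false => hA' | true => hB') (fun | false => hNf | true => hNg)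

end Amalgam

/-! ### Finite groups -/

theorem IsCohopfian.of_finite (G : Type*) [Group G] [Finite G] : IsCohopfian G :=
  fun _ h => Finite.surjective_of_injective h

/-! ### Centers of finite sets of vertices in a tree -/

namespace SimpleGraph

variable {V : Type*} {T : SimpleGraph V}

/-- In a tree, the distance to a vertex is strictly convex along paths. -/
theorem IsTree.dist_lt_max (hT : T.IsTree) {u w m : V} {p : T.Walk u w} (hp : p.IsPath)
    (hm : m ∈ p.support) (hu : m ≠ u) (hw : m ≠ w) (y : V) :
    T.dist m y < max (T.dist u y) (T.dist w y) := by
  classical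
  obtain ⟨q, hq⟩ := hT.connected.exists_walk_length_eq_dist u y
  obtain ⟨r, hr⟩ := hT.connected.exists_walk_length_eq_dist w y
  have key : ∀ {a : V} (s : T.Walk a y), m ∈ s.support → m ≠ a → T.dist m y < s.length := by
    intro a s hs ha
    have h1 := dist_le (s.dropUntil m hs)
    have h2 := congrArg Walk.length (s.take_spec hs)
    rw [Walk.length_append] at h2
    have h3 : (s.takeUntil m hs).length ≠ 0 := fun h => ha (Walk.eq_of_length_eq_zero h).symm
    omega
  -- Every walk from `u` to `w` contains the unique path between them, so `m` lies on one of the two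
  -- geodesics to `y`.
  have hmem : m ∈ (q.append r.reverse).support := by
    have hpath := (q.append r.reverse).bypass_isPath
    have := congrArg Subtype.val ((hT.isAcyclic.subsingleton_path u w).elim
      ⟨_, hpath⟩ ⟨p, hp⟩)
    simp only at this
    exact Walk.support_bypass_subset_support _ (this ▸ hm)
  rw [Walk.mem_support_append_iff, Walk.support_reverse, List.mem_reverse] at hmem
  obtain h | h := hmem
  · exact lt_max_of_lt_left (hq ▸ key q h hu)
  · exact lt_max_of_lt_right (hr ▸ key r h hw)

/-- In a tree, the centers of a nonempty finite set of vertices are equal or adjacent. -/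
theorem IsTree.adj_of_forall_sup_dist_le (hT : T.IsTree) {s : Finset V} (hs : s.Nonempty)
    {u w : V} (huw : u ≠ w) (hu : ∀ v, s.sup (T.dist u) ≤ s.sup (T.dist v))
    (hw : ∀ v, s.sup (T.dist w) ≤ s.sup (T.dist v)) : T.Adj u w := by
  obtain ⟨p, hp, -⟩ := hT.existsUnique_path u w
  cases p with
  | nil => exact absurd rfl huw
  | @cons _ m _ hadj q =>
    by_cases hmw : m = w
    · exact hmw ▸ hadj
    · exfalso
      -- By convexity, a vertex strictly between two centers would have smaller eccentricity than
      -- they have.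
      have hlt : ∀ y ∈ s, T.dist m y < s.sup (T.dist u) := by
        intro y hy
        refine (hT.dist_lt_max hp (by simp) hadj.ne' hmw y).trans_le (max_le ?_ ?_)
        · exact Finset.le_sup (f := T.dist u) hy
        · exact (Finset.le_sup (f := T.dist w) hy).trans (hw u)
      obtain ⟨y, hy⟩ := hs
      exact (hu m).not_gt ((Finset.sup_lt_iff (by
        have := hlt y hy
        exact (Nat.zero_le _).trans_lt this)).2 hlt)

theorem dist_map_iso (σ : T ≃g T) (u v : V) (hT : T.Connected) :
    T.dist (σ u) (σ v) = T.dist u v := by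
  have key : ∀ (σ : T ≃g T) (u v : V), T.dist (σ u) (σ v) ≤ T.dist u v := by
    intro σ u v
    obtain ⟨p, hp⟩ := hT.exists_walk_length_eq_dist u v
    rw [← hp, ← Walk.length_map σ.toHom p]
    exact dist_le _
  refine le_antisymm (key σ u v) ?_
  have := key σ.symm (σ u) (σ v)
  simpa using this

end SimpleGraph

open SimpleGraph in
/-- A finite group fixes the center of each orbit in a tree. -/
theorem PropertyFA.of_finite (G : Type u) [Group G] [Finite G] : PropertyFA G := by
  classical
  intro V T hT ρ
  cases nonempty_fintype G
  obtain ⟨x⟩ := hT.connected.nonempty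
  let s : Finset V := Finset.univ.image fun g : G => ρ g x
  have hs : s.Nonempty := Finset.univ_nonempty.image _
  have hinv : ∀ g v, s.sup (T.dist (ρ g v)) = s.sup (T.dist v) := by
    have hle : ∀ g v, s.sup (T.dist (ρ g v)) ≤ s.sup (T.dist v) := by
      intro g v
      refine Finset.sup_le fun y hy => ?_
      obtain ⟨h, -, rfl⟩ := Finset.mem_image.1 hy
      have hh : ρ h x = ρ g (ρ (g⁻¹ * h) x) := by
        rw [← RelIso.mul_apply, ← map_mul, mul_inv_cancel_left]
      rw [hh, dist_map_iso _ _ _ hT.connected]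
      exact Finset.le_sup (f := T.dist v) (Finset.mem_image_of_mem _ (Finset.mem_univ _))
    intro g v
    refine le_antisymm (hle g v) ?_
    have := hle g⁻¹ (ρ g v)
    rwa [← RelIso.mul_apply, ← map_mul, inv_mul_cancel, map_one, RelIso.one_apply] at this
  obtain ⟨u, hu⟩ : ∃ u, ∀ v, s.sup (T.dist u) ≤ s.sup (T.dist v) := 
    have : Nonempty V := ⟨x⟩
    ⟨_, fun v => Function.argmin_le (fun v => s.sup (T.dist v)) v⟩
  have hgu : ∀ g v, s.sup (T.dist (ρ g u)) ≤ s.sup (T.dist v) := fun g v => hinv g u ▸ hu v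
  by_cases hfix : ∀ g, ρ g u = u
  · exact Or.inl ⟨u, hfix⟩
  · right
    push Not at hfix
    obtain ⟨g, hg⟩ := hfix
    have hadj := hT.adj_of_forall_sup_dist_le hs hg (hgu g) hu
    -- Distinct centers are adjacent and a tree has no triangle, so the orbit of `u` has only two
    -- points.
    have hmem : ∀ h, ρ h u = u ∨ ρ h u = ρ g u := by
      intro h
      by_contra! hne
      have h1 := hT.adj_of_forall_sup_dist_le hs hne.1 (hgu h) hu
      have h2 := hT.adj_of_forall_sup_dist_le hs hne.2 (hgu h) (hgu g)
      have hp : (Walk.cons h1 (Walk.cons hadj.symm Walk.nil)).IsPath := by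
        simp [hne.1, hne.2, Ne.symm hg]
      have hp' : (Walk.cons h2 Walk.nil).IsPath := by simp [hne.2]
      have := congrArg (fun p : T.Path _ _ => p.1.length)
        ((hT.isAcyclic.subsingleton_path _ _).elim ⟨_, hp⟩ ⟨_, hp'⟩)
      simp at this
    refine ⟨s(u, ρ g u), hadj.symm, fun h => ?_⟩
    have hinj : ρ h u ≠ ρ h (ρ g u) := fun e => hg ((ρ h).injective e).symm
    have h1 := hmem h
    have h2 := hmem (h * g)
    rw [map_mul, RelIso.mul_apply] at h2
    rw [Sym2.map_mk, Sym2.eq_iff]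
    obtain h1 | h1 := h1 <;> obtain h2 | h2 := h2
    · exact absurd (h1.trans h2.symm) hinj
    · exact Or.inl ⟨h1, h2⟩
    · exact Or.inr ⟨h1, h2⟩
    · exact absurd (h1.trans h2.symm) hinj

/-! ### Powers of the generators of a free group -/

namespace FreeGroup

variable {α : Type*}

/-- The endomorphism of a free group that raises each generator to the `n`-th power. -/
def powHom (n : ℕ) : FreeGroup α →* FreeGroup α := lift fun a => of a ^ n

@[simp]
theorem powHom_of (n : ℕ) (a : α) : powHom n (of a) = of a ^ n := lift_apply_of

theorem powHom_mk (n : ℕ) (L : List (α × Bool)) :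
    powHom n (mk L) = mk (L.flatMap (List.replicate n)) := by
  have hrep : ∀ x : α × Bool, mk (List.replicate n x) = mk [x] ^ n := by
    intro x
    rw [pow_mk]
    congr 1
    simp
  induction L with
  | nil => exact _root_.map_one (powHom n)
  | cons x L ih =>
    rw [List.flatMap_cons, ← mul_mk, ← ih, hrep, ← List.singleton_append, ← mul_mk,
      _root_.map_mul]
    congr 1
    obtain ⟨a, b⟩ := x
    cases b
    · have : mk [(a, false)] = (of a)⁻¹ := rfl
      rw [this, _root_.map_inv, powHom_of, inv_pow]
    · exact powHom_of n a

/-- Cancellation can occur neither inside a block of equal letters nor between two blocks, where the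
adjacent letters are adjacent in `L`. -/
theorem IsReduced.flatMap_replicate {n : ℕ} (hn : n ≠ 0) {L : List (α × Bool)}
    (hL : IsReduced L) : IsReduced (L.flatMap (List.replicate n)) := by
  obtain ⟨n, rfl⟩ := Nat.exists_eq_succ_of_ne_zero hn
  induction L with
  | nil => exact hL
  | cons x L ih =>
    have hx : IsReduced (List.replicate (n + 1) x) :=
      List.isChain_replicate_of_rel _ fun _ => rfl
    rw [List.flatMap_cons]
    refine List.IsChain.append hx (ih (hL.infix ⟨[x], [], by simp⟩)) ?_
    cases L with
    | nil => simp
    | cons y L =>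
      rw [isReduced_cons_cons] at hL
      intro a ha b hb
      rw [List.getLast?_replicate, if_neg n.succ_ne_zero, Option.mem_some_iff] at ha
      rw [List.flatMap_cons, List.replicate_succ, List.cons_append, List.head?_cons,
        Option.mem_some_iff] at hb
      exact ha ▸ hb ▸ hL.1

theorem powHom_injective {n : ℕ} (hn : n ≠ 0) : Function.Injective (powHom (α := α) n) := by
  classical
  rw [injective_iff_map_eq_one]
  intro w hw
  rw [← mk_toWord (x := w), powHom_mk] at hw
  have hred := (isReduced_toWord (x := w)).flatMap_replicate hn
  have h := congrArg toWord hw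
  rw [toWord_mk, hred.reduce_eq, toWord_one] at h
  rw [← toWord_eq_nil_iff]
  by_contra hne
  obtain ⟨x, hx⟩ := List.exists_mem_of_ne_nil _ hne
  have := (List.flatMap_eq_nil_iff.1 h) x hx
  simp [hn] at this

theorem of_mul_of_ne {a b : α} (hab : a ≠ b) : of a * of b ≠ of b * of a := by
  classical
  intro h
  have := congrArg toWord h
  simp [of, toWord_mk, reduce, hab] at this

theorem of_pow_mul_of_pow_ne {a b : α} (hab : a ≠ b) {n : ℕ} (hn : n ≠ 0) :
    of a ^ n * of b ^ n ≠ of b ^ n * of a ^ n := by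
  intro h
  apply of_mul_of_ne hab
  apply powHom_injective hn
  simpa using h

/-- All values of `powHom 2` have even exponent sum, and a generator does not. -/
theorem not_isCohopfian [Nonempty α] : ¬ IsCohopfian (FreeGroup α) := by
  intro h
  obtain ⟨a⟩ := ‹Nonempty α›
  obtain ⟨w, hw⟩ := h (powHom 2) (powHom_injective two_ne_zero) (of a)
  let χ : FreeGroup α →* Multiplicative (ZMod 2) := lift fun _ => Multiplicative.ofAdd 1
  have hχ : χ.comp (powHom 2) = 1 := by
    ext x
    simp only [χ, MonoidHom.comp_apply, powHom_of, map_pow, lift_apply_of]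
    rfl
  have h1 := DFunLike.congr_fun hχ w
  rw [MonoidHom.comp_apply, hw] at h1
  simp only [χ, lift_apply_of, MonoidHom.one_apply] at h1
  exact absurd h1 (by decide)

end FreeGroup

theorem IsCohopfian.of_mulEquiv {G H : Type*} [Group G] [Group H] (e : G ≃* H)
    (hG : IsCohopfian G) : IsCohopfian H := by
  intro F hF x
  obtain ⟨y, hy⟩ := hG ((e.symm.toMonoidHom.comp F).comp e.toMonoidHom)
    ((e.symm.injective.comp hF).comp e.injective) (e.symm x)
  exact ⟨e y, e.symm.injective hy⟩

/-! ### The universal property of amalgamated products of two groups -/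

namespace AmalgamatedProduct

open Monoid

variable {A B C : Type u} [Group A] [Group B] [Group C] {f : C →* A} {g : C →* B}
  {K : Type*} [Group K]

/-- The left factor of an amalgamated product. -/
def inl : A →* AmalgamatedProduct f g := PushoutI.of (φ := Amalgam.factorMap f g) false

/-- The right factor of an amalgamated product. -/
def inr : B →* AmalgamatedProduct f g := PushoutI.of (φ := Amalgam.factorMap f g) true

theorem inl_map_eq_inr_map (c : C) :
    (inl (f c) : AmalgamatedProduct f g) = inr (g c) :=
  (PushoutI.of_apply_eq_base (Amalgam.factorMap f g) false c).trans
    (PushoutI.of_apply_eq_base (Amalgam.factorMap f g) true c).symm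

/-- The homomorphism from an amalgamated product given by compatible homomorphisms from the
factors. -/
def desc (p : A →* K) (q : B →* K) (h : p.comp f = q.comp g) : AmalgamatedProduct f g →* K :=
  PushoutI.lift (fun | false => p | true => q) (p.comp f) (by rintro (_ | _); exacts [rfl, h.symm])

@[simp]
theorem desc_inl (p : A →* K) (q : B →* K) (h : p.comp f = q.comp g) (a : A) :
    desc p q h (inl a) = p a := PushoutI.lift_of (φ := Amalgam.factorMap f g) (i := false) ..

@[simp]
theorem desc_inr (p : A →* K) (q : B →* K) (h : p.comp f = q.comp g) (b : B) :
    desc p q h (inr b) = q b := PushoutI.lift_of (φ := Amalgam.factorMap f g) (i := true) ..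

theorem range_inl_sup_range_inr :
    (inl : A →* AmalgamatedProduct f g).range ⊔ (inr : B →* AmalgamatedProduct f g).range = ⊤ :=
  Amalgam.eq_top_of_factor_le fun i => by cases i; exacts [le_sup_left, le_sup_right]

theorem fg_of_finite [Finite A] [Finite B] : Group.FG (AmalgamatedProduct f g) := by
  refine ⟨Subgroup.fg_iff _ |>.2 ⟨Set.range (inl (f := f) (g := g)) ∪ Set.range inr, ?_,
    (Set.finite_range _).union (Set.finite_range _)⟩⟩
  rw [Subgroup.closure_union, ← MonoidHom.coe_range, ← MonoidHom.coe_range, Subgroup.closure_eq,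
    Subgroup.closure_eq, range_inl_sup_range_inr]

end AmalgamatedProduct

/-! ### The double of the symmetric group -/

namespace SymDouble

open Equiv AmalgamatedProduct

theorem symInclusion_apply_last (c : Perm (Fin 2)) : symInclusion c 2 = 2 :=
  Perm.viaEmbedding_apply_of_notMem c Fin.castSuccEmb 2 (by decide)

theorem symInclusion_swap : symInclusion (swap 0 1) = swap 0 1 := by
  have h0 : symInclusion (swap 0 1) 0 = 1 :=
    Perm.viaEmbedding_apply (swap 0 1) Fin.castSuccEmb (0 : Fin 2)
  have h1 : symInclusion (swap 0 1) 1 = 0 :=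
    Perm.viaEmbedding_apply (swap 0 1) Fin.castSuccEmb (1 : Fin 2)
  ext i
  fin_cases i
  · simp [h0]
  · simp [h1]
  · simp [symInclusion_apply_last, swap_apply_of_ne_of_ne]

theorem mem_range_symInclusion {σ : Perm (Fin 3)} : σ ∈ symInclusion.range ↔ σ 2 = 2 := by
  constructor
  · rintro ⟨c, rfl⟩
    exact symInclusion_apply_last c
  · intro h
    have : ∀ σ : Perm (Fin 3), σ 2 = 2 → σ = 1 ∨ σ = swap 0 1 := by decide
    obtain rfl | rfl := this σ h
    · exact one_mem _
    · exact ⟨_, symInclusion_swap⟩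

theorem symInclusion_injective : Function.Injective symInclusion :=
  Perm.viaEmbeddingHom_injective _

theorem normalizer_range_symInclusion :
    Subgroup.normalizer (symInclusion.range : Set (Perm (Fin 3))) = symInclusion.range := by
  refine le_antisymm (fun σ hσ => ?_) Subgroup.le_normalizer
  have h := (Subgroup.mem_normalizer_iff.1 hσ (swap 0 1)).1 ⟨_, symInclusion_swap⟩
  change σ * swap 0 1 * σ⁻¹ ∈ symInclusion.range at h
  rw [mem_range_symInclusion] at h ⊢
  -- The conjugate is the transposition of `σ 0` and `σ 1`, whose only fixed point is `σ 2`.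
  have : ∀ σ : Perm (Fin 3), (σ * swap 0 1 * σ⁻¹ : Perm (Fin 3)) 2 = 2 → σ 2 = 2 := by decide
  exact this σ h

theorem isCohopfian : IsCohopfian SymDouble :=
  Amalgam.isCohopfian_amalgamatedProduct _ _ symInclusion_injective symInclusion_injective
    (.of_finite _) (.of_finite _) (.of_finite _) (.of_finite _) (.of_finite _)
    normalizer_range_symInclusion normalizer_range_symInclusion

/-- The folding map. -/
noncomputable def fold : SymDouble →* Perm (Fin 3) := desc (MonoidHom.id _) (MonoidHom.id _) rfl

@[simp]
theorem fold_inl (σ : Perm (Fin 3)) : fold (inl σ) = σ := desc_inl ..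

@[simp]
theorem fold_inr (σ : Perm (Fin 3)) : fold (inr σ) = σ := desc_inr ..

theorem index_ker_fold : fold.ker.index = 6 := by
  rw [Subgroup.index_ker, MonoidHom.range_eq_top.2 fun σ => ⟨inl σ, fold_inl σ⟩,
    Subgroup.card_top, Nat.card_eq_fintype_card, Fintype.card_perm]
  rfl

/-- The differences of the two copies of a permutation. -/
noncomputable def diff (σ : Perm (Fin 3)) : SymDouble := inr σ * (inl σ)⁻¹

/-- This cocycle identity expresses the conjugate of a difference by `inl σ` through differences,
which makes the subgroup they generate invariant under the left factor. -/
theorem diff_mul (σ τ : Perm (Fin 3)) : diff (σ * τ) = diff σ * (inl σ * diff τ * (inl σ)⁻¹) := by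
  simp only [diff, map_mul]
  group

theorem diff_eq_one {σ : Perm (Fin 3)} (h : σ 2 = 2) : diff σ = 1 := by
  obtain ⟨c, rfl⟩ := mem_range_symInclusion.2 h
  rw [diff, inl_map_eq_inr_map, mul_inv_cancel]

/-- The cocycle is trivial on `S₂`, so it depends only on the coset of `σ`, that is, on `σ 2`. This
leaves two nontrivial generators. -/
theorem diff_eq_diff_swap (σ : Perm (Fin 3)) : diff σ = diff (swap (σ 2) 2) := by
  have h : diff (swap (σ 2) 2 * σ) = 1 := diff_eq_one (by simp)
  conv_lhs => rw [← swap_mul_self_mul (σ 2) 2 σ, diff_mul, h, mul_one, mul_inv_cancel, mul_one]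

/-- The homomorphism from the free group of rank two, whose image is the kernel of the folding
map. -/
noncomputable def freeHom : FreeGroup {p : Fin 3 // p ≠ 2} →* SymDouble :=
  FreeGroup.lift fun p => diff (swap p.1 2)

theorem diff_mem_range_freeHom (σ : Perm (Fin 3)) : diff σ ∈ freeHom.range := by
  by_cases h : σ 2 = 2
  · rw [diff_eq_one h]
    exact one_mem _
  · rw [diff_eq_diff_swap]
    exact ⟨FreeGroup.of ⟨σ 2, h⟩, FreeGroup.lift_apply_of⟩

theorem conj_mem_range_freeHom (σ : Perm (Fin 3)) {x : SymDouble} (hx : x ∈ freeHom.range) :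
    inl σ * x * (inl σ)⁻¹ ∈ freeHom.range := by
  obtain ⟨w, rfl⟩ := hx
  induction w using FreeGroup.induction_on with
  | C1 => simp
  | of p =>
    have h : inl σ * freeHom (FreeGroup.of p) * (inl σ)⁻¹ =
        (diff σ)⁻¹ * diff (σ * swap p.1 2) := by
      rw [diff_mul, inv_mul_cancel_left, freeHom, FreeGroup.lift_apply_of]
    rw [h]
    exact mul_mem (inv_mem (diff_mem_range_freeHom _)) (diff_mem_range_freeHom _)
  | inv_of p h =>
    have := inv_mem h
    rw [map_inv]
    convert this using 1
    group
  | mul x y hx hy =>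
    rw [map_mul]
    convert mul_mem hx hy using 1
    group

/-- Elements of this form are closed under products because `inl` normalizes the range of `freeHom`,
and they include the right factor because `inr σ = diff σ * inl σ`. -/
theorem exists_eq_mul_inl (g : SymDouble) : ∃ n ∈ freeHom.range, ∃ σ, g = n * inl σ := by
  have hmul : ∀ g h : SymDouble, (∃ n ∈ freeHom.range, ∃ σ, g = n * inl σ) →
      (∃ n ∈ freeHom.range, ∃ σ, h = n * inl σ) →
      ∃ n ∈ freeHom.range, ∃ σ, g * h = n * inl σ := by
    rintro _ _ ⟨n, hn, σ, rfl⟩ ⟨m, hm, τ, rfl⟩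
    refine ⟨n * (inl σ * m * (inl σ)⁻¹), mul_mem hn (conj_mem_range_freeHom σ hm), σ * τ, ?_⟩
    rw [map_mul]
    group
  have hinl : ∀ σ, ∃ n ∈ freeHom.range, ∃ τ, (inl σ : SymDouble) = n * inl τ :=
    fun σ => ⟨1, one_mem _, σ, (one_mul _).symm⟩
  induction g using Monoid.PushoutI.induction_on with
  | of i σ =>
    cases i
    · exact hinl σ
    · exact ⟨diff σ, diff_mem_range_freeHom σ, σ, (inv_mul_cancel_right (inr σ) (inl σ)).symm⟩
  | base c =>
    rw [← Monoid.PushoutI.of_apply_eq_base _ false]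
    exact hinl (symInclusion c)
  | mul x y hx hy => exact hmul x y hx hy

theorem range_freeHom : freeHom.range = fold.ker := by
  refine le_antisymm ?_ fun g hg => ?_
  · rw [MonoidHom.range_le_ker_iff]
    ext p : 1
    simp [freeHom, diff]
  · obtain ⟨n, hn, σ, rfl⟩ := exists_eq_mul_inl g
    obtain ⟨w, rfl⟩ := hn
    have hw : fold (freeHom w) = 1 := by
      have : fold.comp freeHom = 1 := by
        ext p : 1
        simp [freeHom, diff]
      exact DFunLike.congr_fun this w
    rw [MonoidHom.mem_ker, map_mul, hw, one_mul, fold_inl] at hg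
    rw [hg, map_one, mul_one]
    exact ⟨w, rfl⟩

/-! ### Freeness of the kernel of the folding map -/

/-- Permutations of the generators of the free group of rank three. -/
def permRep : Perm (Fin 3) →* Perm (FreeGroup (Fin 3)) where
  toFun σ := (FreeGroup.freeGroupCongr σ).toEquiv
  map_one' := by
    ext1 w
    simp [FreeGroup.freeGroupCongr]
  map_mul' σ τ := by
    ext1 w
    simp [FreeGroup.freeGroupCongr, FreeGroup.map.comp]

theorem permRep_apply (σ : Perm (Fin 3)) (w : FreeGroup (Fin 3)) :
    permRep σ w = FreeGroup.map σ w := rfl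

/-- The action of the double on the free group of rank three, in which the second factor acts by
a translate of the action of the first one. -/
noncomputable def rep : SymDouble →* Perm (FreeGroup (Fin 3)) :=
  desc permRep ((MulAut.conj (Equiv.mulLeft (FreeGroup.of 2)⁻¹)).toMonoidHom.comp permRep) <| by
    -- The second factor sends `w` to `x₂⁻¹ * σ (x₂ * w)`, with `x₂` the last generator; this is `σ
    -- w` if `σ` fixes the last point.
    ext c w
    simp [permRep_apply, symInclusion_apply_last]

theorem rep_diff (σ : Perm (Fin 3)) (w : FreeGroup (Fin 3)) :
    rep (diff σ) w = (FreeGroup.of 2)⁻¹ * FreeGroup.of (σ 2) * w := by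
  have h : FreeGroup.map σ ((permRep σ).symm w) = w := (permRep σ).apply_symm_apply w
  simp [rep, diff, permRep_apply, h, mul_assoc]

/-- Under `rep`, the generator `p` acts as left multiplication by `x₂⁻¹ * x_p`, so evaluation at `1`
recovers `ι w`. Killing `x₂` gives a retraction `r` of `ι`. -/
theorem freeHom_injective : Function.Injective freeHom := by
  let ι : FreeGroup {p : Fin 3 // p ≠ 2} →* FreeGroup (Fin 3) :=
    FreeGroup.lift fun p => (FreeGroup.of 2)⁻¹ * FreeGroup.of p.1
  let r : FreeGroup (Fin 3) →* FreeGroup {p : Fin 3 // p ≠ 2} :=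
    FreeGroup.lift fun p => if h : p ≠ 2 then FreeGroup.of ⟨p, h⟩ else 1
  have hr : r.comp ι = MonoidHom.id _ := by
    ext p
    simp [r, ι, p.2]
  have hι : rep.comp freeHom = (MulAction.toPermHom _ (FreeGroup (Fin 3))).comp ι := by
    ext p w
    simp [freeHom, ι, rep_diff]
  rw [injective_iff_map_eq_one]
  intro w hw
  have h1 : ι w = 1 := by
    have := DFunLike.congr_fun (DFunLike.congr_fun hι w) 1
    simpa [hw] using this.symm
  have h2 := DFunLike.congr_fun hr w
  rw [MonoidHom.comp_apply, h1, map_one] at h2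
  exact h2.symm

/-- The kernel of the folding map is free of rank two. -/
noncomputable def kerFoldEquiv : FreeGroup {p : Fin 3 // p ≠ 2} ≃* fold.ker :=
  (MonoidHom.ofInjective freeHom_injective).trans (MulEquiv.subgroupCongr range_freeHom)

theorem isFreeGroup_ker_fold : IsFreeGroup fold.ker := IsFreeGroup.ofMulEquiv kerFoldEquiv

theorem not_isCohopfian_ker_fold : ¬ IsCohopfian fold.ker := fun h =>
  have : Nonempty {p : Fin 3 // p ≠ 2} := ⟨⟨0, by decide⟩⟩
  FreeGroup.not_isCohopfian (h.of_mulEquiv kerFoldEquiv.symm)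

theorem exists_mul_ne_mul_ker_fold : ∃ x y : fold.ker, x * y ≠ y * x := by
  refine ⟨kerFoldEquiv (.of ⟨0, by decide⟩), kerFoldEquiv (.of ⟨1, by decide⟩), fun h => ?_⟩
  rw [← map_mul, ← map_mul] at h
  exact FreeGroup.of_mul_of_ne (by decide) (kerFoldEquiv.injective h)

/-- A subgroup of finite index contains powers of both free generators with a common positive
exponent, and these do not commute. -/
theorem not_virtually_cyclic : ¬ ∃ K : Subgroup SymDouble, K.FiniteIndex ∧ IsCyclic K := by
  rintro ⟨K, hK, hcyc⟩
  let x : FreeGroup {p : Fin 3 // p ≠ 2} := .of ⟨0, by decide⟩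
  let y : FreeGroup {p : Fin 3 // p ≠ 2} := .of ⟨1, by decide⟩
  obtain ⟨m, hm, -, hmK⟩ :=
    Subgroup.exists_pow_mem_of_index_ne_zero hK.index_ne_zero (freeHom x)
  obtain ⟨n, hn, -, hnK⟩ :=
    Subgroup.exists_pow_mem_of_index_ne_zero hK.index_ne_zero (freeHom y)
  have hx : freeHom x ^ (m * n) ∈ K := by rw [pow_mul]; exact pow_mem hmK n
  have hy : freeHom y ^ (m * n) ∈ K := by rw [mul_comm, pow_mul]; exact pow_mem hnK m
  let := hcyc.commGroup
  have h : freeHom x ^ (m * n) * freeHom y ^ (m * n) =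
      freeHom y ^ (m * n) * freeHom x ^ (m * n) :=
    congrArg Subtype.val (mul_comm (⟨_, hx⟩ : K) ⟨_, hy⟩)
  simp only [← map_pow, ← map_mul] at h
  exact FreeGroup.of_pow_mul_of_pow_ne (by decide) (Nat.mul_pos hm hn).ne' (freeHom_injective h)

end SymDouble

theorem mainTheorem12 :
    -- the criterion: `C` is a common subgroup of `A` and `B`, through `f` and `g`
    (∀ (A B C : Type u) [Group A] [Group B] [Group C] (f : C →* A) (g : C →* B),
      Function.Injective f → Function.Injective g →
      IsCohopfian A → IsCohopfian B → IsCohopfian C →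
      PropertyFA A → PropertyFA B →
      Subgroup.normalizer (f.range : Set A) = f.range →
      Subgroup.normalizer (g.range : Set B) = g.range →
      IsCohopfian (AmalgamatedProduct f g)) ∧
    -- `S₃ *_{S₂} S₃` is cohopfian and finitely generated
    IsCohopfian SymDouble ∧ Group.FG SymDouble ∧
    -- it is non-elementary, that is, not virtually cyclic
    (¬ ∃ K : Subgroup SymDouble, K.FiniteIndex ∧ IsCyclic K) ∧
    -- it has a non-abelian free subgroup of index 6, which is not cohopfian
    (∃ H : Subgroup SymDouble, H.index = 6 ∧ IsFreeGroup H ∧ (∃ x y : H, x * y ≠ y * x) ∧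
      ¬ IsCohopfian H) ∧
    -- being cohopfian does not pass to subgroups of finite index
    ¬ (∀ (G : Type) [Group G], IsCohopfian G →
      ∀ H : Subgroup G, H.FiniteIndex → IsCohopfian H) := by
  have hfin : SymDouble.fold.ker.FiniteIndex :=
    ⟨by rw [SymDouble.index_ker_fold]; decide⟩
  exact ⟨fun _ _ _ _ _ _ f g => Amalgam.isCohopfian_amalgamatedProduct f g,
    SymDouble.isCohopfian, AmalgamatedProduct.fg_of_finite, SymDouble.not_virtually_cyclic,
    ⟨SymDouble.fold.ker, SymDouble.index_ker_fold, SymDouble.isFreeGroup_ker_fold,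
      SymDouble.exists_mul_ne_mul_ker_fold, SymDouble.not_isCohopfian_ker_fold⟩,
    fun h => SymDouble.not_isCohopfian_ker_fold (h _ SymDouble.isCohopfian _ hfin)⟩
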